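/- Let $n\ge 2$ be an even integer and let $S\subseteq\mathbb{Z}_n\setminus\{0\}$ be symmetric ($s\in S\Rightarrow -s\in S$). Let $G$ be the circulant graph $\mathrm{Cay}(\mathbb{Z}_n,S)$, that is, the simple graph with vertex set $\mathbb{Z}_n$ in which $g$ and $g+s$ are adjacent for all $g\in\mathbb{Z}_n$, $s\in S$, and let $\Delta(G)$ be its maximum degree. Put $k=\lfloor n/4\rfloor$ and $S_1=\{1,2,\dots,k,\,n-k,\dots,n-1\}\subseteq\mathbb{Z}_n$ (so $S_1=\emptyset$ if $k=0$). Assume that $\Delta(G)\ge \frac n2$ and that (i) $\frac n2\notin S$; (ii) $S_1\subseteq S$; (iii) $S\setminus S_1$ generates the group $\mathbb{Z}_n$. Then $\chi''(G)\le\Delta(G)+2$, i.e. $G$ satisfies the Total Coloring Conjecture. Here $\chi''(G)$ is the total chromatic number: the least number of colors in a coloring of the vertices and edges of $G$ in which no two adjacent vertices, no two distinct edges with a common end, and no edge and either of its ends receive the same color. -/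

import Mathlib

namespace SimpleGraph

/-- The vertex colouring `cv` and the edge colouring `ce` together form a total colouring of `G`:
adjacent vertices, adjacent edges (distinct edges with a common end), and an edge and
each of its ends never receive the same colour. -/
structure IsTotalColoring {V α : Type*} (G : SimpleGraph V) (cv : V → α) (ce : G.edgeSet → α) :
    Prop where
  vertex_ne : ∀ u v : V, G.Adj u v → cv u ≠ cv v
  edge_ne : ∀ e f : G.edgeSet, e ≠ f →
    (∃ v : V, v ∈ (e : Sym2 V) ∧ v ∈ (f : Sym2 V)) → ce e ≠ ce f
  incident_ne : ∀ (v : V) (e : G.edgeSet), v ∈ (e : Sym2 V) → cv v ≠ ce e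

/-- `G` has a total colouring with (at most) `k` colours. -/
def TotallyColorable {V : Type*} (G : SimpleGraph V) (k : ℕ) : Prop :=
  ∃ (cv : V → Fin k) (ce : G.edgeSet → Fin k), G.IsTotalColoring cv ce

/-- The total chromatic number: the least number of colours in a total colouring
(`⊤` if no finite number of colours suffices). -/
noncomputable def totalChromaticNumber {V : Type*} (G : SimpleGraph V) : ℕ∞ :=
  ⨅ k : {k : ℕ // G.TotallyColorable k}, ((k : ℕ) : ℕ∞)

end SimpleGraph

/-- The generating set `{1, …, k, n - k, …, n - 1}` of the power of cycle `C_n^k`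
(used for `k ≤ n`). -/
def cyclePowerGenerators (n k : ℕ) : Set (ZMod n) :=
  {x | ∃ d : ℕ, 1 ≤ d ∧ d ≤ k ∧ (x = (d : ZMod n) ∨ x = ((n - d : ℕ) : ZMod n))}

/-!
Write `n = 4 k` or `n = 4 k + 2`, let `S₁` be the set of residues at distance `1, …, k` from `0`,
and let `T = S \ S₁`.  The edges of `Cay(ℤ_n, S₁)` and all vertices are coloured with `2 k + 2`
colours, and the edges of `Cay(ℤ_n, T)` with `|T|` further colours.  As `|S₁| = 2 k` (only
`2 k ≤ |S₁|` is needed), the total is at most `|S| + 2`.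

*The power of a cycle.*  Project `ℤ_n` to the residues modulo `n / 2`, which is `2 k` or `2 k + 1`,
and read these as elements of `ℤ_{2k+1}`.  A vertex with image `r` gets the colour `2 r`, and an
edge whose ends have images `r`, `r'` gets `r + r'`.  Doubling is injective modulo the odd number
`2 k + 1`, so two vertices share a colour only if they differ by `n / 2`, which is not in `S`.
Conflicts at a vertex `u` arise only from two neighbours with the same image; these differ by
`n / 2`, hence `n = 4 k` and they are `u + k` and `u - k`.  A perfect matching made of edges of
length `k` receives the last colour and removes exactly these conflicts
(`CyclePower.Near.edgeColor_ne`).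

*The remaining generators.*  As `T` generates `ℤ_n` and `n` is even, `T` has an odd element `a`.
The even elements of `T` give isomorphic graphs on the two cosets of the even residues, and these
are coloured identically by Vizing's theorem, with one colour more than the degree.  The colour
missing at `x` and `x + a` goes to the edge between them, and each odd generator other than `a`
contributes one perfect matching with a colour of its own
(`exists_edge_coloring_of_odd_generator`).

*Vizing's theorem* (`SimpleGraph.exists_edge_coloring_of_degree_lt`) is proved by fans and Kempe
chains.  A colour class is encoded as an involution of the vertices, so that a Kempe chain is a
cycle of the product of two involutions, and the fact that a chain has only two ends becomes the
statement `Equiv.Perm.not_sameCycle_of_three_fixed` about dihedral groups.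
-/

/-! ### Kempe chains and Vizing's theorem -/

/-- Two involutions `g`, `h` of a finite type generate a dihedral group, and the orbit of a fixed
point of `g` is a single cycle of `h * g`.  It contains at most two points that are fixed by
`g` or by `h`: these are the two ends of a Kempe chain. -/
theorem Equiv.Perm.not_sameCycle_of_three_fixed {V : Type*} [Finite V] {g h : Equiv.Perm V}
    (hg : g * g = 1) (hh : h * h = 1) {v u w : V} (hv : g v = v)
    (hu : g u = u ∨ h u = u) (hw : g w = w ∨ h w = w) (hvu : v ≠ u) (hvw : v ≠ w) (huw : u ≠ w)
    (hcu : (h * g).SameCycle v u) (hcw : (h * g).SameCycle v w) : False := by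
  set σ := h * g with hσ
  have hgi : g⁻¹ = g := inv_eq_of_mul_eq_one_left hg
  have hhi : h⁻¹ = h := inv_eq_of_mul_eq_one_left hh
  have hσi : σ⁻¹ = g * h := by rw [hσ, mul_inv_rev, hgi, hhi]
  have hconj : ∀ i : ℤ, g * σ ^ i = σ ^ (-i) * g := by
    intro i
    have h1 : g * σ * g⁻¹ = σ⁻¹ := by
      rw [hσi, hσ]; simp [mul_assoc]
    have h2 : g * σ ^ i * g⁻¹ = σ ^ (-i) := by
      rw [← conj_zpow, h1, inv_zpow, zpow_neg]
    rw [← h2]; simp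
  have hgact : ∀ i : ℤ, g ((σ ^ i) v) = (σ ^ (-i)) v := by
    intro i
    have := congrArg (fun p : Equiv.Perm V => p v) (hconj i)
    simpa [Equiv.Perm.mul_apply, hv] using this
  have hback : ∀ i j : ℤ, (σ ^ i) v = (σ ^ j) v → (σ ^ (i - j)) v = v := by
    intro i j hij
    have : σ ^ (i - j) = σ ^ (-j) * σ ^ i := by rw [← zpow_add]; congr 1; ring
    rw [this, Equiv.Perm.mul_apply, hij, ← Equiv.Perm.mul_apply, ← zpow_add]; simp
  -- the position of a fixed point along the cycle is determined up to the parity of the period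
  have hfix : ∀ i : ℤ, (g ((σ ^ i) v) = (σ ^ i) v ∨ h ((σ ^ i) v) = (σ ^ i) v) →
      (σ ^ (2 * i)) v = v ∨ (σ ^ (2 * i - 1)) v = v := by
    rintro i (hi | hi)
    · left
      have := hback i (-i) (by rw [← hi, hgact])
      rwa [show i - -i = 2 * i by ring] at this
    · right
      have h1 : (σ ^ (i - 1)) v = (σ ^ (-i)) v := by
        rw [← hgact i]
        have : σ ^ (i - 1) = σ⁻¹ * σ ^ i := by
          rw [← zpow_neg_one, ← zpow_add]; congr 1; ring
        rw [this, hσi, Equiv.Perm.mul_apply, Equiv.Perm.mul_apply, hi]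
      have := hback _ _ h1
      rwa [show i - 1 - -i = 2 * i - 1 by ring] at this
  obtain ⟨i, rfl⟩ := hcu
  obtain ⟨j, rfl⟩ := hcw
  set L : ℤ := (Function.minimalPeriod (σ • ·) v : ℤ) with hL
  have hdvd : ∀ m : ℤ, (σ ^ m) v = v ↔ L ∣ m := fun m =>
    MulAction.zpow_smul_eq_iff_minimalPeriod_dvd (a := σ) (b := v) (n := m)
  have hi0 : ¬ L ∣ i := fun hd => hvu ((hdvd i).2 hd).symm
  have hj0 : ¬ L ∣ j := fun hd => hvw ((hdvd j).2 hd).symm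
  have hij : ¬ L ∣ i - j := by
    intro hd
    apply huw
    have h1 := (hdvd _).2 hd
    have h2 : σ ^ i = σ ^ j * σ ^ (i - j) := by rw [← zpow_add]; congr 1; ring
    rw [h2, Equiv.Perm.mul_apply, h1]
  have hu' := hfix i hu
  have hw' := hfix j hw
  rw [hdvd, hdvd] at hu' hw'
  have half : ∀ t p : ℤ, 2 * t = L * p → ¬ L ∣ t → Odd p := by
    intro t p hp hn
    by_contra hne
    rw [Int.not_odd_iff_even] at hne
    obtain ⟨q, rfl⟩ := hne
    exact hn ⟨q, by linarith⟩
  rcases hu' with ⟨p, hp⟩ | ⟨p, hp⟩ <;> rcases hw' with ⟨q, hq⟩ | ⟨q, hq⟩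
  · have h1 := half _ _ hp hi0
    have h2 := half _ _ hq hj0
    have h3 := half (i - j) (p - q) (by linarith) hij
    exact (Int.not_even_iff_odd.2 h3) (h1.sub_odd h2)
  · have h1 := half _ _ hp hi0
    have h2 : Odd (L * q) := hq ▸ ⟨j - 1, by ring⟩
    have h3 : Even (L * p) := hp ▸ ⟨i, by ring⟩
    rw [Int.odd_mul] at h2
    rw [Int.even_mul] at h3
    rcases h3 with h3 | h3
    · exact (Int.not_even_iff_odd.2 h2.1) h3
    · exact (Int.not_even_iff_odd.2 h1) h3
  · have h1 := half _ _ hq hj0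
    have h2 : Odd (L * p) := hp ▸ ⟨i - 1, by ring⟩
    have h3 : Even (L * q) := hq ▸ ⟨j, by ring⟩
    rw [Int.odd_mul] at h2
    rw [Int.even_mul] at h3
    rcases h3 with h3 | h3
    · exact (Int.not_even_iff_odd.2 h2.1) h3
    · exact (Int.not_even_iff_odd.2 h1) h3
  · have h1 : Odd (L * p) := hp ▸ ⟨i - 1, by ring⟩
    have h2 : Odd (L * q) := hq ▸ ⟨j - 1, by ring⟩
    rw [Int.odd_mul] at h1 h2
    have h3 := half (i - j) (p - q) (by linarith) hij
    exact (Int.not_even_iff_odd.2 h3) (h1.2.sub_odd h2.2)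

/-- A properly edge-coloured graph, encoded by one involution `c.toFun a` of the vertices for each
colour `a`: it swaps the ends of each edge of colour `a` and fixes the vertices at which `a` is
missing.  The underlying graph is `MatchingColoring.Adj`. -/
structure MatchingColoring (V C : Type*) where
  toFun : C → V → V
  invol : ∀ a v, toFun a (toFun a v) = v
  inj : ∀ a b v, toFun a v ≠ v → toFun a v = toFun b v → a = b

namespace MatchingColoring

variable {V C : Type*}

/-- Adjacency in the underlying graph: two vertices swapped by the involution of some colour. -/
def Adj (c : MatchingColoring V C) (u v : V) : Prop := u ≠ v ∧ ∃ a, c.toFun a u = v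

open Classical in
/-- Give the colour `e`, missing at both `x` and `y`, to the new edge `xy`. -/
noncomputable def addEdge (c : MatchingColoring V C) (x y : V) (e : C) (hxy : x ≠ y)
    (hn : ¬ c.Adj x y) (hx : c.toFun e x = x) (hy : c.toFun e y = y) : MatchingColoring V C where
  toFun a v := if a = e ∧ v = x then y else if a = e ∧ v = y then x else c.toFun a v
  invol a v := by
    have := c.invol a v
    grind
  inj a b v h1 h2 := by
    have h3 := c.inj a b v
    have h4 : ∀ a, c.toFun a x ≠ y := fun a ha => hn ⟨hxy, a, ha⟩
    have h5 : ∀ a, c.toFun a y ≠ x := fun a ha => h4 a (by rw [← ha, c.invol])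
    grind

open Classical in
/-- Delete the edge `xy`. -/
noncomputable def removeEdge (c : MatchingColoring V C) (x y : V) : MatchingColoring V C where
  toFun a v :=
    if (v = x ∧ c.toFun a v = y) ∨ (v = y ∧ c.toFun a v = x) then v else c.toFun a v
  invol a v := by
    have := c.invol a v
    grind
  inj a b v h1 h2 := by
    have h3 := c.inj a b v
    grind

open Classical in
/-- Exchange the colours `a` and `b` on a set `K` that is a union of `a`-`b` Kempe chains. -/
noncomputable def kempeSwap (c : MatchingColoring V C) (a b : C) (K : Set V)
    (ha : ∀ v ∈ K, c.toFun a v ∈ K) (hb : ∀ v ∈ K, c.toFun b v ∈ K) : MatchingColoring V C where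
  toFun d v := if v ∈ K then c.toFun (Equiv.swap a b d) v else c.toFun d v
  invol d v := by
    have h1 := c.invol d v
    have h2 := c.invol (Equiv.swap a b d) v
    have h3 := ha v
    have h4 := hb v
    have h5 := ha (c.toFun d v)
    have h6 := hb (c.toFun d v)
    rw [Equiv.swap_apply_def] at *
    grind
  inj d d' v h1 h2 := by
    have h3 := c.inj d d' v
    have h4 := c.inj (Equiv.swap a b d) (Equiv.swap a b d') v
    have h5 := (Equiv.swap a b).injective (a₁ := d) (a₂ := d')
    grind

theorem kempeSwap_adj (c : MatchingColoring V C) (a b : C) (K : Set V)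
    (ha : ∀ v ∈ K, c.toFun a v ∈ K) (hb : ∀ v ∈ K, c.toFun b v ∈ K) (u v : V) :
    (c.kempeSwap a b K ha hb).Adj u v ↔ c.Adj u v := by
  classical
  unfold Adj kempeSwap
  refine and_congr_right fun _ => ?_
  by_cases hu : u ∈ K
  · simp only [hu, if_true]
    constructor
    · rintro ⟨d, hd⟩; exact ⟨_, hd⟩
    · rintro ⟨d, hd⟩; exact ⟨Equiv.swap a b d, by simpa using hd⟩
  · simp [hu]

/-- Shifting a fan: the edges from `x` to `y 1, …, y k` are coloured, the edge to `y 0` is not, the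
colour of the edge to `y (i + 1)` is missing at `y i`, and some colour `e` is missing at both `x`
and `y k`.  Moving each colour one step down the fan frees the edge to `y k`, which gets the
colour `e`. -/
theorem exists_adj_iff_of_fan (c : MatchingColoring V C) (x : V) (k : ℕ) (y : ℕ → V) (d : ℕ → C)
    (e : C) (hx : ∀ i ≤ k, y i ≠ x) (hn : ¬ c.Adj x (y 0))
    (hd : ∀ i < k, c.toFun (d i) x = y (i + 1)) (hm : ∀ i < k, c.toFun (d i) (y i) = y i)
    (hinj : ∀ i ≤ k, ∀ j ≤ k, y i = y j → i = j) (hex : c.toFun e x = x)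
    (hey : c.toFun e (y k) = y k) :
    ∃ c' : MatchingColoring V C, ∀ u v, c'.Adj u v ↔
      c.Adj u v ∨ (u = x ∧ v = y 0) ∨ (u = y 0 ∧ v = x) := by
  classical
  induction k generalizing c y d with
  | zero =>
    have hxy : x ≠ y 0 := (hx 0 le_rfl).symm
    refine ⟨c.addEdge x (y 0) e hxy hn hex hey, fun u v => ?_⟩
    simp only [Adj, addEdge]
    constructor
    · rintro ⟨huv, a, ha⟩
      grind
    · rintro (⟨huv, a, ha⟩ | ⟨rfl, rfl⟩ | ⟨rfl, rfl⟩)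
      · exact ⟨huv, a, by grind⟩
      · exact ⟨hxy, e, by grind⟩
      · exact ⟨hxy.symm, e, by grind⟩
  | succ k ih =>
    have h0 := hx 0 (by omega)
    have h1 := hx 1 (by omega)
    have h01 : y 0 ≠ y 1 := fun h => by have := hinj 0 (by omega) 1 (by omega) h; omega
    have hd0 : c.toFun (d 0) x = y 1 := hd 0 (by omega)
    have hm0 := hm 0 (by omega)
    have hd1 : c.toFun (d 0) (y 1) = x := by rw [← hd0, c.invol]
    have hu : ∀ a, c.toFun a x = y 1 → a = d 0 := fun a ha =>
      c.inj a (d 0) x (by rw [ha]; exact h1) (by rw [ha, hd0])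
    have hu' : ∀ a, c.toFun a (y 1) = x → a = d 0 := fun a ha =>
      hu a (by rw [← ha, c.invol])
    have hn' : ∀ a, c.toFun a x ≠ y 0 := fun a ha => hn ⟨h0.symm, a, ha⟩
    set c₁ := c.removeEdge x (y 1) with hc₁
    have e1 : ∀ a v, c₁.toFun a v =
      if (v = x ∧ c.toFun a v = y 1) ∨ (v = y 1 ∧ c.toFun a v = x) then v else c.toFun a v :=
        fun _ _ => rfl
    have k1 : ¬ c₁.Adj x (y 0) := by
      rintro ⟨-, a, ha⟩
      rw [e1] at ha
      have := hn' a
      grind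
    have k2 : c₁.toFun (d 0) x = x := by rw [e1]; grind
    have k3 : c₁.toFun (d 0) (y 0) = y 0 := by rw [e1]; grind
    set c₂ := c₁.addEdge x (y 0) (d 0) h0.symm k1 k2 k3 with hc₂
    have e2 : ∀ a v, c₂.toFun a v = if a = d 0 ∧ v = x then y 0 else
      if a = d 0 ∧ v = y 0 then x else c₁.toFun a v := fun _ _ => rfl
    have hne : ∀ i < k, d (i + 1) ≠ d 0 := by
      intro i hi h
      have h2 := hd (i + 1) (by omega)
      rw [h, hd0] at h2
      have := hinj 1 (by omega) (i + 1 + 1) (by omega) h2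
      omega
    have hed : e ≠ d 0 := by
      rintro rfl
      exact h1 (hd0 ▸ hex)
    -- away from the colour of the moved edge nothing has changed
    have hsame : ∀ a, a ≠ d 0 → ∀ v, c₂.toFun a v = c.toFun a v := by
      intro a ha v
      rw [e2, e1]
      have := hu a
      have := hu' a
      grind
    obtain ⟨c', hc'⟩ := ih c₂ (fun i => y (i + 1)) (fun i => d (i + 1))
      (fun i hi => hx _ (by omega))
      (by
        rintro ⟨-, a, ha⟩
        by_cases h : a = d 0
        · rw [e2] at ha
          grind
        · rw [hsame a h] at ha
          exact h (hu a ha))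
      (fun i hi => by rw [hsame _ (hne i hi)]; exact hd _ (by omega))
      (fun i hi => by rw [hsame _ (hne i hi)]; exact hm _ (by omega))
      (fun i hi j hj h => by have := hinj _ (by omega) _ (by omega) h; omega)
      (by rw [hsame _ hed]; exact hex)
      (by rw [hsame _ hed]; exact hey)
    refine ⟨c', fun u v => ?_⟩
    rw [hc']
    simp only [Adj]
    constructor
    · rintro (⟨huv, a, ha⟩ | ⟨rfl, rfl⟩ | ⟨rfl, rfl⟩)
      · rw [e2, e1] at ha
        grind
      · exact Or.inl ⟨h1.symm, d 0, hd0⟩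
      · exact Or.inl ⟨h1, d 0, hd1⟩
    · rintro (⟨huv, a, ha⟩ | ⟨rfl, rfl⟩ | ⟨rfl, rfl⟩)
      · by_cases h : a = d 0
        · subst h
          by_cases hux : u = x
          · grind
          · by_cases huy : u = y 1
            · grind
            · refine Or.inl ⟨huv, d 0, ?_⟩
              rw [e2, e1]
              grind
        · exact Or.inl ⟨huv, a, by rw [hsame a h]; exact ha⟩
      · exact Or.inl ⟨h0.symm, d 0, by rw [e2]; simp⟩
      · exact Or.inl ⟨h0, d 0, by rw [e2]; simp [h0]⟩

/-- The `a`-`b` Kempe chain of a vertex `y` at which `a` or `b` is missing, as a cycle of the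
product of the two involutions. -/
def chain (c : MatchingColoring V C) (a b : C) (y : V) : Set V :=
  {v | (Function.Involutive.toPerm _ (c.invol b) *
    Function.Involutive.toPerm _ (c.invol a)).SameCycle y v}

theorem mem_chain_self (c : MatchingColoring V C) (a b : C) (y : V) : y ∈ c.chain a b y :=
  Equiv.Perm.SameCycle.refl _ _

theorem mem_chain_comm (c : MatchingColoring V C) {a b : C} {y z : V} :
    z ∈ c.chain a b y ↔ y ∈ c.chain a b z :=
  Equiv.Perm.sameCycle_comm

theorem chain_closed_left (c : MatchingColoring V C) (a b : C) (y : V)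
    (h : c.toFun a y = y ∨ c.toFun b y = y) : ∀ v ∈ c.chain a b y, c.toFun a v ∈ c.chain a b y := by
  rintro v ⟨i, rfl⟩
  set g := Function.Involutive.toPerm _ (c.invol a) with hg
  set k := Function.Involutive.toPerm _ (c.invol b) with hk
  have hgg : g⁻¹ = g := rfl
  have hkk : k⁻¹ = k := rfl
  have h2 : g * (k * g) ^ i * g⁻¹ = (k * g) ^ (-i) := by
    rw [← conj_zpow, zpow_neg, ← inv_zpow, mul_inv_rev, hgg, hkk]
    congr 1
    rw [mul_assoc, mul_assoc, show g * g = 1 from by nth_rw 1 [← hgg]; simp, mul_one]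
  have h3 : c.toFun a (((k * g) ^ i) y) = ((k * g) ^ (-i)) (g y) := by
    rw [← h2, Equiv.Perm.mul_apply, Equiv.Perm.mul_apply,
      show g⁻¹ (g y) = y from g.symm_apply_apply y]
    rfl
  change (k * g).SameCycle y (c.toFun a (((k * g) ^ i) y))
  rw [h3, Equiv.Perm.sameCycle_zpow_right]
  rcases h with h | h
  · rw [show g y = y from h]
  · have : g y = (k * g)⁻¹ y := by
      rw [mul_inv_rev, hgg, hkk, Equiv.Perm.mul_apply, show k y = y from h]
    rw [this]
    exact ⟨-1, by simp⟩

theorem chain_closed_right (c : MatchingColoring V C) (a b : C) (y : V)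
    (h : c.toFun a y = y ∨ c.toFun b y = y) : ∀ v ∈ c.chain a b y, c.toFun b v ∈ c.chain a b y := by
  intro v hv
  -- applying `b` to `v` is rotating the point obtained from `v` by applying `a`
  have h1 := c.chain_closed_left a b y h v hv
  have h2 : c.toFun b v = (Function.Involutive.toPerm _ (c.invol b) *
      Function.Involutive.toPerm _ (c.invol a)) (c.toFun a v) := by
    exact congrArg (c.toFun b) (c.invol a v).symm
  rw [h2]
  exact Equiv.Perm.sameCycle_apply_right.2 h1

/-- Vizing's extension step: if every vertex misses a colour, then a new edge `xy` can be coloured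
after recolouring the others. -/
theorem exists_adj_iff_insert [Finite V] (c : MatchingColoring V C) (x y₀ : V) (hxy : x ≠ y₀)
    (hn : ¬ c.Adj x y₀) (m : V → C) (hm : ∀ v, c.toFun (m v) v = v) :
    ∃ c' : MatchingColoring V C, ∀ u v, c'.Adj u v ↔
      c.Adj u v ∨ (u = x ∧ v = y₀) ∨ (u = y₀ ∧ v = x) := by
  classical
  -- the fan: the next vertex is joined to `x` by the colour chosen to be missing at the last one
  set Y : ℕ → V := fun i => (fun y => c.toFun (m y) x)^[i] y₀ with hY
  have hY0 : Y 0 = y₀ := rfl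
  have hYs : ∀ i, Y (i + 1) = c.toFun (m (Y i)) x := fun i => by
    simp only [hY, Function.iterate_succ_apply']
  have hYn : ¬ c.Adj x (Y 0) := hn
  by_cases hend : ∃ i, Y (i + 1) = x
  · -- the fan ends at a vertex missing a colour that is also missing at `x`
    set k := Nat.find hend with hk
    have hkx : Y (k + 1) = x := Nat.find_spec hend
    have hmin : ∀ i ≤ k, Y i ≠ x := by
      intro i hi h
      rcases i with _ | i
      · exact hxy h.symm
      · exact Nat.find_min hend (m := i) (by omega) h
    have hper : ∀ i j t, Y i = Y j → Y (i + t) = Y (j + t) := by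
      intro i j t h
      induction t with
      | zero => exact h
      | succ t ih => rw [← add_assoc, ← add_assoc, hYs, hYs, ih]
    have hlt : ∀ i j, i < j → j ≤ k → Y i ≠ Y j := by
      intro i j hij hj h
      have h1 := hper i j (k + 1 - j) h
      rw [show j + (k + 1 - j) = k + 1 by omega, hkx] at h1
      exact hmin _ (by omega) h1
    exact exists_adj_iff_of_fan c x k Y (fun i => m (Y i)) (m (Y k)) hmin hYn
      (fun i _ => (hYs i).symm) (fun i _ => hm _)
      (fun i hi j hj h => by
        rcases lt_trichotomy i j with hl | hl | hl
        · exact absurd h (hlt i j hl hj)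
        · exact hl
        · exact absurd h.symm (hlt j i hl hi))
      (by rw [← hYs]; exact hkx) (hm _)
  · push Not at hend
    have hYx : ∀ i, Y i ≠ x := by
      rintro (_ | i)
      · exact hxy.symm
      · exact hend i
    have hrep : ∃ j, ∃ i < j, Y i = Y j := by
      obtain ⟨i, j, hij, h⟩ := Finite.exists_ne_map_eq_of_infinite Y
      rcases lt_or_gt_of_ne hij with hl | hl
      · exact ⟨j, i, hl, h⟩
      · exact ⟨i, j, hl, h.symm⟩
    obtain ⟨i, hij, hYij⟩ := Nat.find_spec hrep
    have hmin : ∀ t < Nat.find hrep, ¬ ∃ s < t, Y s = Y t := fun t ht => Nat.find_min hrep ht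
    generalize Nat.find hrep = j at hij hYij hmin
    have hlt : ∀ s t, s < t → t < j → Y s ≠ Y t := fun s t hst ht h =>
      hmin t ht ⟨s, hst, h⟩
    have hinj : ∀ s < j, ∀ t < j, Y s = Y t → s = t := by
      intro s hs t ht h
      rcases lt_trichotomy s t with hl | hl | hl
      · exact absurd h (hlt s t hl ht)
      · exact hl
      · exact absurd h.symm (hlt t s hl hs)
    obtain ⟨q, rfl⟩ : ∃ q, j = q + 1 := ⟨j - 1, by omega⟩
    obtain ⟨p, rfl⟩ : ∃ p, i = p + 1 := by
      rcases i with _ | p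
      · exact absurd ⟨(hYx 0).symm, m (Y q), by rw [← hYs, hYij]⟩ hYn
      · exact ⟨p, rfl⟩
    -- the same colour `d` is chosen at `Y p` and at `Y q`, and `e` is missing at `x`
    have hd : m (Y p) = m (Y q) := by
      refine c.inj _ _ x ?_ ?_
      · rw [← hYs]; exact hend p
      · rw [← hYs, ← hYs, hYij]
    set d := m (Y q) with hdq
    set e := m x with he
    have hme : ∀ s, m (Y s) ≠ e := by
      intro s h
      apply hend s
      rw [hYs, h]; exact hm x
    -- the `e`-`d` chain of `x` cannot end at both `Y p` and `Y q`
    obtain ⟨r, hrq, hrd, hrx, hrp⟩ : ∃ r ≤ q, m (Y r) = d ∧ x ∉ c.chain e d (Y r) ∧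
        (r ≤ p ∨ Y p ∉ c.chain e d (Y r)) := by
      by_cases hp : Y p ∈ c.chain e d x
      · have hq : Y q ∉ c.chain e d x := by
          intro hq
          refine Equiv.Perm.not_sameCycle_of_three_fixed
            (g := Function.Involutive.toPerm _ (c.invol e))
            (h := Function.Involutive.toPerm _ (c.invol d))
            (Equiv.ext fun v => c.invol e v) (Equiv.ext fun v => c.invol d v)
            (v := x) (hm x) (Or.inr ?_) (Or.inr (hm (Y q))) (hYx p).symm (hYx q).symm
            (hlt p q (by omega) (by omega)) hp hq
          change c.toFun d (Y p) = Y p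
          rw [← hd]; exact hm _
        refine ⟨q, le_rfl, rfl, fun h => hq (c.mem_chain_comm.1 h), Or.inr fun h => hq ?_⟩
        exact c.mem_chain_comm.1 (Equiv.Perm.SameCycle.trans h (c.mem_chain_comm.1 hp))
      · exact ⟨p, by omega, hd, fun h => hp (c.mem_chain_comm.1 h), Or.inl le_rfl⟩
    have hmr : c.toFun d (Y r) = Y r := by rw [← hrd]; exact hm _
    set K := c.chain e d (Y r) with hK
    set c' := c.kempeSwap e d K (c.chain_closed_left e d _ (Or.inr hmr))
      (c.chain_closed_right e d _ (Or.inr hmr)) with hc'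
    have hadj : ∀ u v, c'.Adj u v ↔ c.Adj u v := kempeSwap_adj _ _ _ _ _ _
    have hin : ∀ a, ∀ v ∈ K, c'.toFun a v = c.toFun (Equiv.swap e d a) v := fun a v hv =>
      if_pos hv
    have hout : ∀ a, ∀ v ∉ K, c'.toFun a v = c.toFun a v := fun a v hv => if_neg hv
    have hother : ∀ a, a ≠ e → a ≠ d → ∀ v, c'.toFun a v = c.toFun a v := by
      intro a h1 h2 v
      by_cases hv : v ∈ K
      · rw [hin a v hv, Equiv.swap_apply_of_ne_of_ne h1 h2]
      · exact hout a v hv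
    obtain ⟨c'', hc''⟩ := exists_adj_iff_of_fan c' x r Y (fun i => m (Y i)) e
      (fun i _ => hYx i) (by rw [hadj]; exact hYn)
      (fun i _ => by rw [hout _ _ hrx]; exact (hYs i).symm)
      (fun s hs => by
        by_cases hsd : m (Y s) = d
        · -- only the vertex `Y p` of the fan has `d` as its chosen colour
          have h1 : Y (s + 1) = Y (p + 1) := by rw [hYs, hYs, hsd, hd]
          have h2 := hinj _ (by omega) _ (by omega) h1
          obtain rfl : s = p := by omega
          rw [hout _ _ (hrp.resolve_left (by omega))]
          exact hm _
        · rw [hother _ (hme s) hsd]; exact hm _)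
      (fun s hs t ht h => hinj s (by omega) t (by omega) h)
      (by rw [hout _ _ hrx]; exact hm x)
      (by rw [hin _ _ (c.mem_chain_self e d (Y r)), Equiv.swap_apply_left]; exact hmr)
    exact ⟨c'', fun u v => by rw [hc'', hadj, hY0]⟩

/-- If there are more colours than the degree of `v`, then one of them is missing at `v`. -/
theorem exists_missing [Fintype C] (c : MatchingColoring V C) (v : V) (s : Finset V)
    (hs : ∀ w, c.Adj v w → w ∈ s) (hC : s.card < Fintype.card C) : ∃ a, c.toFun a v = v := by
  by_contra! h
  refine hC.not_ge ?_
  rw [← Finset.card_univ]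
  refine Finset.card_le_card_of_injOn (fun a => c.toFun a v)
    (fun a _ => hs _ ⟨(h a).symm, a, rfl⟩) ?_
  intro a _ b _ hab
  exact c.inj a b v (h a) hab

end MatchingColoring

/-- Vizing's theorem, for a finite simple graph and any number of colours exceeding all degrees.
The colouring is a function on pairs of vertices whose values off the edges are irrelevant. -/
theorem SimpleGraph.exists_edge_coloring_of_degree_lt {V C : Type*} [Fintype V] [Fintype C]
    (G : SimpleGraph V) [DecidableRel G.Adj] (hC : ∀ v, G.degree v < Fintype.card C) :
    ∃ F : V → V → C, (∀ u v, G.Adj u v → F u v = F v u) ∧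
      ∀ u v w, G.Adj u v → G.Adj u w → F u v = F u w → v = w := by
  classical
  have hmiss : ∀ c : MatchingColoring V C, (∀ u v, c.Adj u v → G.Adj u v) →
      ∀ v, ∃ a, c.toFun a v = v := fun c hc v =>
    c.exists_missing v (G.neighborFinset v) (fun w hw => by simpa using hc v w hw) (hC v)
  -- take a coloured subgraph that is as large as possible
  let P : Set (SimpleGraph V) :=
    {H | H ≤ G ∧ ∃ c : MatchingColoring V C, ∀ u v, c.Adj u v ↔ H.Adj u v}
  have hP : (⊥ : SimpleGraph V) ∈ P := by
    refine ⟨bot_le, ⟨fun _ v => v, fun _ _ => rfl, fun _ _ _ h => absurd rfl h⟩, fun u v => ?_⟩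
    simp only [MatchingColoring.Adj, SimpleGraph.bot_adj, iff_false]
    exact fun h => h.1 h.2.choose_spec
  obtain ⟨H, ⟨⟨hHG, c, hc⟩, hmax⟩⟩ := (Set.toFinite P).exists_maximal ⟨_, hP⟩
  have hcG : ∀ u v, c.Adj u v → G.Adj u v := fun u v h => hHG ((hc u v).1 h)
  have hGc : ∀ u v, G.Adj u v → c.Adj u v := by
    intro x y hxy
    by_contra hn
    choose m hm using hmiss c hcG
    obtain ⟨c', hc'⟩ := c.exists_adj_iff_insert x y hxy.ne hn m hm
    have hmem : H ⊔ SimpleGraph.edge x y ∈ P := by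
      refine ⟨sup_le hHG ?_, c', fun u v => ?_⟩
      · rw [SimpleGraph.edge_le_iff]
        exact Or.inr hxy
      · rw [hc', hc, SimpleGraph.sup_adj, SimpleGraph.edge_adj]
        have := hxy.ne
        grind
    have hle := hmax hmem le_sup_left
    refine hn ((hc _ _).2 (hle ?_))
    rw [SimpleGraph.sup_adj, SimpleGraph.edge_adj]
    exact Or.inr ⟨Or.inl ⟨rfl, rfl⟩, hxy.ne⟩
  have hcol : ∀ u v, ∃ a : C, G.Adj u v → c.toFun a u = v := by
    intro u v
    by_cases h : G.Adj u v
    · obtain ⟨-, a, ha⟩ := hGc u v h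
      exact ⟨a, fun _ => ha⟩
    · obtain ⟨a, -⟩ := hmiss c hcG u
      exact ⟨a, fun h' => absurd h' h⟩
  choose F hF using hcol
  refine ⟨F, fun u v h => ?_, fun u v w huv huw h => ?_⟩
  · have h1 := hF u v h
    refine c.inj _ _ u (by rw [h1]; exact h.ne') ?_
    rw [h1]
    nth_rw 2 [← hF v u h.symm]
    rw [c.invol]
  · rw [← hF u v huv, h]
    exact hF u w huw

/-! ### One-factorizations of Cayley graphs -/

/-- A Cayley graph of a finite abelian group whose generating set `T` contains an element `a`
outside some subgroup of index two is `|T|`-edge-colourable.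

The generators in the subgroup give isomorphic graphs on the two cosets, which are coloured in the
same way with one colour more than their degree, by Vizing's theorem.  Then `x` and `x + a` miss a
common colour, which is given to the edge between them.  Each other odd generator gives a perfect
matching between the cosets, with its own colour. -/
theorem exists_edge_coloring_of_odd_generator {A : Type*} [AddCommGroup A] [Fintype A]
    (π : A →+ ZMod 2) (T : Finset A) (h0 : (0 : A) ∉ T) (hT : ∀ s ∈ T, -s ∈ T) {a : A}
    (ha : a ∈ T) (hπ : π a ≠ 0) :
    ∃ F : A → A → Fin T.card, (∀ u v, v - u ∈ T → F u v = F v u) ∧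
      ∀ u v w, v - u ∈ T → w - u ∈ T → F u v = F u w → v = w := by
  classical
  have hz : ∀ z : ZMod 2, z = 0 ∨ z = 1 := by decide
  have hπ1 : π a = 1 := (hz _).resolve_left hπ
  set B := T.filter (fun s => π s = 0) with hB
  set O := (T.filter (fun s => ¬ π s = 0)).erase a with hO
  let H : SimpleGraph A :=
    { Adj := fun u v => v - u ∈ B
      symm := ⟨fun u v h => by
        rw [hB, Finset.mem_filter] at h ⊢
        rw [← neg_sub]
        exact ⟨hT _ h.1, by rw [map_neg, h.2, neg_zero]⟩⟩
      loopless := ⟨fun u h => by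
        rw [sub_self, hB, Finset.mem_filter] at h
        exact h0 h.1⟩ }
  have hHadj : ∀ u v, H.Adj u v ↔ v - u ∈ B := fun _ _ => Iff.rfl
  have hdeg : ∀ u, H.degree u ≤ B.card := fun u =>
    Finset.card_le_card_of_injOn (fun v => v - u)
      (fun v hv => by simpa [hHadj] using hv) (fun v _ w _ h => sub_left_injective h)
  obtain ⟨F₀, hsymm, hprop⟩ := H.exists_edge_coloring_of_degree_lt (C := Fin (B.card + 1))
    (fun v => by rw [Fintype.card_fin]; exact Nat.lt_succ_of_le (hdeg v))
  have hmiss : ∀ u, ∃ m, ∀ v, H.Adj u v → F₀ u v ≠ m := by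
    intro u
    by_contra! h
    have h1 : (Finset.univ : Finset (Fin (B.card + 1))) ⊆ (H.neighborFinset u).image (F₀ u) := by
      intro m _
      obtain ⟨v, hv, hm⟩ := h m
      exact Finset.mem_image.2 ⟨v, by simpa using hv, hm⟩
    have h2 := (Finset.card_le_card h1).trans Finset.card_image_le
    rw [Finset.card_univ, Fintype.card_fin, SimpleGraph.card_neighborFinset_eq_degree] at h2
    exact absurd h2 (by have := hdeg u; omega)
  choose μ hμ using hmiss
  have hcard : Fintype.card (Fin (B.card + 1) ⊕ O) = T.card := by
    have h1 : a ∈ T.filter (fun s => ¬ π s = 0) := Finset.mem_filter.2 ⟨ha, hπ⟩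
    have h2 := Finset.card_erase_add_one h1
    have h3 := Finset.card_filter_add_card_filter_not (s := T) (fun s => π s = 0)
    rw [Fintype.card_sum, Fintype.card_fin, Fintype.card_coe, hB, hO]
    omega
  suffices h : ∃ F : A → A → Fin (B.card + 1) ⊕ O, (∀ u v, v - u ∈ T → F u v = F v u) ∧
      ∀ u v w, v - u ∈ T → w - u ∈ T → F u v = F u w → v = w by
    obtain ⟨F, h1, h2⟩ := h
    let E := Fintype.equivFinOfCardEq hcard
    exact ⟨fun u v => E (F u v), fun u v h => congrArg E (h1 u v h),
      fun u v w hv hw h => h2 u v w hv hw (E.injective h)⟩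
  -- the even representative of a vertex, and the even and the odd end of an edge between cosets
  let base : A → A := fun u => if π u = 0 then u else u - a
  let ev : A → A → A := fun u v => if π u = 0 then u else v
  let od : A → A → A := fun u v => if π u = 0 then v else u
  have hbase : ∀ u v, π u = π v → v - u ∈ T → H.Adj (base u) (base v) := by
    intro u v huv h
    have h1 : base v - base u = v - u := by
      simp only [base, huv]
      split_ifs <;> abel
    rw [hHadj, h1, hB, Finset.mem_filter]
    exact ⟨h, by rw [map_sub, huv, sub_self]⟩
  have hcross : ∀ u v, π u ≠ π v → ev u v = ev v u ∧ od u v = od v u := by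
    intro u v huv
    have h1 : (1 : ZMod 2) ≠ 0 := one_ne_zero
    rcases hz (π u) with hu | hu <;> rcases hz (π v) with hv | hv
    · exact absurd (hu.trans hv.symm) huv
    · simp only [ev, od, hu, hv, if_pos, if_neg h1, and_self]
    · simp only [ev, od, hu, hv, if_pos, if_neg h1, and_self]
    · exact absurd (hu.trans hv.symm) huv
  have hodd : ∀ u v, π u ≠ π v → v - u ∈ T → od u v - ev u v ∉ O → od u v - ev u v = a := by
    intro u v huv h hnO
    by_contra hne
    apply hnO
    rw [hO, Finset.mem_erase, Finset.mem_filter]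
    refine ⟨hne, ?_, ?_⟩
    · simp only [od, ev]
      split_ifs
      · exact h
      · rw [← neg_sub]; exact hT _ h
    · simp only [od, ev]
      split_ifs
      · rw [map_sub, sub_eq_zero]; exact huv.symm
      · rw [map_sub, sub_eq_zero]; exact huv
  have hevbase : ∀ u v, π u ≠ π v → od u v - ev u v = a → ev u v = base u := by
    intro u v huv h
    simp only [od, ev, base] at h ⊢
    split_ifs at h ⊢
    · rfl
    · rw [← h]; abel
  have hother : ∀ u v w, π u ≠ π v → π u ≠ π w →
      od u v - ev u v = od u w - ev u w → v = w := by
    intro u v w _ _ h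
    simp only [od, ev] at h
    split_ifs at h
    · exact sub_left_injective h
    · exact sub_right_injective h
  let F : A → A → Fin (B.card + 1) ⊕ O := fun u v =>
    if π u = π v then Sum.inl (F₀ (base u) (base v))
    else if h : od u v - ev u v ∈ O then Sum.inr ⟨_, h⟩ else Sum.inl (μ (ev u v))
  have F1 : ∀ u v, π u = π v → F u v = Sum.inl (F₀ (base u) (base v)) := fun u v h => if_pos h
  have F2 : ∀ u v, π u ≠ π v → ∀ h : od u v - ev u v ∈ O, F u v = Sum.inr ⟨_, h⟩ :=
    fun u v h h' => by simp only [F]; rw [if_neg h, dif_pos h']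
  have F3 : ∀ u v, π u ≠ π v → v - u ∈ T → od u v - ev u v ∉ O → F u v = Sum.inl (μ (base u)) :=
    fun u v h hT' h' => by
      simp only [F]; rw [if_neg h, dif_neg h', hevbase u v h (hodd u v h hT' h')]
  refine ⟨F, fun u v h => ?_, fun u v w hv hw h => ?_⟩
  · by_cases huv : π u = π v
    · rw [F1 u v huv, F1 v u huv.symm, hsymm _ _ (hbase u v huv h)]
    · have huv' : π v ≠ π u := fun h' => huv h'.symm
      obtain ⟨h1, h2⟩ := hcross u v huv
      simp only [F, if_neg huv, if_neg huv', h1, h2]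
  · by_cases huv : π u = π v <;> by_cases huw : π u = π w
    · rw [F1 u v huv, F1 u w huw] at h
      have h1 := hprop _ _ _ (hbase u v huv hv) (hbase u w huw hw) (Sum.inl_injective h)
      simp only [base, ← huv, ← huw] at h1
      split_ifs at h1
      · exact h1
      · exact sub_left_injective h1
    · rw [F1 u v huv] at h
      by_cases hO' : od u w - ev u w ∈ O
      · rw [F2 u w huw hO'] at h; cases h
      · rw [F3 u w huw hw hO'] at h
        exact absurd (Sum.inl_injective h) (hμ _ _ (hbase u v huv hv))
    · rw [F1 u w huw] at h
      by_cases hO' : od u v - ev u v ∈ O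
      · rw [F2 u v huv hO'] at h; cases h
      · rw [F3 u v huv hv hO'] at h
        exact absurd (Sum.inl_injective h).symm (hμ _ _ (hbase u w huw hw))
    · by_cases h1 : od u v - ev u v ∈ O <;> by_cases h2 : od u w - ev u w ∈ O
      · rw [F2 u v huv h1, F2 u w huw h2] at h
        exact hother u v w huv huw (congrArg Subtype.val (Sum.inr_injective h))
      · rw [F2 u v huv h1, F3 u w huw hw h2] at h; cases h
      · rw [F3 u v huv hv h1, F2 u w huw h2] at h; cases h
      · exact hother u v w huv huw
          ((hodd u v huv hv h1).trans (hodd u w huw hw h2).symm)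

/-! ### Total colourings of powers of cycles -/

namespace CyclePower

/-- Closeness of two residues `u, v < n` on the cycle: their distance is between `1` and `k`. -/
def Near (n k u v : ℕ) : Prop :=
  ∃ d, 1 ≤ d ∧ d ≤ k ∧ (v = u + d ∨ v + n = u + d ∨ v + d = u ∨ v + d = u + n)

/-- The residue modulo `n / 2` of a number `u < n`. -/
def half (n u : ℕ) : ℕ := if u < n / 2 then u else u - n / 2

/-- The residue modulo `M` of a number `s < 2 * M`. -/
def reduce (M s : ℕ) : ℕ := if s < M then s else s - M

/-- When `n = 4 k`, the perfect matching of all pairs `{u, u + k}` with `u` in the first or the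
third quarter of `0, …, n - 1`; when `n` is not a multiple of `4`, nothing. -/
def Extra (n k u v : ℕ) : Prop :=
  n = 4 * k ∧ ((v = u + k ∧ (u < k ∨ 2 * k ≤ u ∧ u < 3 * k)) ∨
    (u = v + k ∧ (v < k ∨ 2 * k ≤ v ∧ v < 3 * k)))

instance (n k u v : ℕ) : Decidable (Extra n k u v) := by unfold Extra; infer_instance

/-- The colour of a vertex, the double of its half-residue in the integers modulo `2 k + 1`. -/
def vertexColor (n k u : ℕ) : ℕ := reduce (2 * k + 1) (half n u + half n u)

/-- The colour of an edge: `2 k + 1` on the matching `Extra`, and elsewhere the sum of the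
half-residues of the ends in the integers modulo `2 k + 1`. -/
def edgeColor (n k u v : ℕ) : ℕ :=
  if Extra n k u v then 2 * k + 1 else reduce (2 * k + 1) (half n u + half n v)

variable {n k u v w : ℕ}

theorem reduce_inj {M r s t : ℕ} (hs : s < M) (ht : t < M)
    (h : reduce M (r + s) = reduce M (r + t)) : s = t := by
  unfold reduce at h
  split_ifs at h <;> omega

theorem reduce_double_inj {k s t : ℕ}
    (h : reduce (2 * k + 1) (s + s) = reduce (2 * k + 1) (t + t)) : s = t := by
  unfold reduce at h
  split_ifs at h <;> omega

theorem reduce_lt {M s : ℕ} (hs : s < 2 * M) : reduce M s < M := by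
  unfold reduce
  split_ifs <;> omega

theorem half_lt (hn : Even n) (hk : k = n / 4) (hu : u < n) : half n u < 2 * k + 1 := by
  obtain ⟨m, rfl⟩ := hn
  unfold half
  split_ifs <;> omega

theorem Near.half_ne (hn : Even n) (hk : k = n / 4) (hu : u < n) (hv : v < n)
    (h : Near n k u v) : half n u ≠ half n v := by
  obtain ⟨m, rfl⟩ := hn
  obtain ⟨d, h1, h2, h3⟩ := h
  unfold half
  split_ifs <;> omega

theorem Extra.unique (hu : u < n) (h : Extra n k u v) (h' : Extra n k u w) : v = w := by
  unfold Extra at h h'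
  omega

theorem Extra.symm (h : Extra n k u v) : Extra n k v u := by
  unfold Extra at h ⊢
  omega

/-- Two vertices with the same half-residue have distance `n / 2`, so they have a common neighbour
`u` only when `n = 4 k` and they are `u + k` and `u - k`; one of the two edges is in `Extra`. -/
theorem Near.extra_of_half_eq (hn : Even n) (hk : k = n / 4) (hu : u < n) (hv : v < n)
    (hw : w < n) (h : Near n k u v) (h' : Near n k u w) (hvw : v ≠ w) (he : half n v = half n w) :
    Extra n k u v ∨ Extra n k u w := by
  obtain ⟨m, rfl⟩ := hn
  obtain ⟨d, h1, h2, h3⟩ := h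
  obtain ⟨d', h1', h2', h3'⟩ := h'
  have hm : (m + m) / 2 = m := by omega
  have hvw' : v = w + m ∨ w = v + m := by
    unfold half at he
    rw [hm] at he
    split_ifs at he <;> omega
  have h4 : m = 2 * k ∨ m = 2 * k + 1 := by omega
  unfold Extra
  clear he hm hk
  rcases h4 with rfl | rfl
  · have hd : d = k ∧ d' = k := by
      rcases hvw' with rfl | rfl <;> rcases h3 with h3 | h3 | h3 | h3 <;>
        rcases h3' with h3' | h3' | h3' | h3' <;> omega
    obtain ⟨rfl, rfl⟩ := hd
    rcases hvw' with rfl | rfl <;> rcases h3 with h3 | h3 | h3 | h3 <;>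
        rcases h3' with h3' | h3' | h3' | h3' <;> omega
  · rcases hvw' with rfl | rfl <;> rcases h3 with h3 | h3 | h3 | h3 <;>
        rcases h3' with h3' | h3' | h3' | h3' <;> omega

theorem vertexColor_lt (hn : Even n) (hk : k = n / 4) (hu : u < n) :
    vertexColor n k u < 2 * k + 1 :=
  reduce_lt (by have := half_lt hn hk hu; omega)

theorem edgeColor_lt (hn : Even n) (hk : k = n / 4) (hu : u < n) (hv : v < n) :
    edgeColor n k u v < 2 * k + 2 := by
  unfold edgeColor
  split_ifs
  · omega
  · exact (reduce_lt (by have := half_lt hn hk hu; have := half_lt hn hk hv; omega)).trans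
      (Nat.lt_succ_self _)

theorem edgeColor_comm : edgeColor n k u v = edgeColor n k v u := by
  unfold edgeColor
  rw [add_comm (half n v)]
  exact if_congr ⟨Extra.symm, Extra.symm⟩ rfl rfl

theorem eq_or_eq_add_of_vertexColor_eq (h : vertexColor n k u = vertexColor n k v) :
    u = v ∨ v = u + n / 2 ∨ u = v + n / 2 := by
  have h1 : half n u = half n v := reduce_double_inj h
  unfold half at h1
  split_ifs at h1 <;> omega

theorem Near.vertexColor_ne_edgeColor (hn : Even n) (hk : k = n / 4) (hu : u < n) (hv : v < n)
    (h : Near n k u v) : vertexColor n k u ≠ edgeColor n k u v := by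
  intro he
  unfold edgeColor at he
  split_ifs at he
  · exact (vertexColor_lt hn hk hu).ne he
  · exact h.half_ne hn hk hu hv
      (reduce_inj (half_lt hn hk hu) (half_lt hn hk hv) he)

theorem Near.edgeColor_ne (hn : Even n) (hk : k = n / 4) (hu : u < n) (hv : v < n)
    (hw : w < n) (h : Near n k u v) (h' : Near n k u w) (hvw : v ≠ w) :
    edgeColor n k u v ≠ edgeColor n k u w := by
  have hlt : ∀ x, x < n → reduce (2 * k + 1) (half n u + half n x) < 2 * k + 1 := fun x hx =>
    reduce_lt (by have := half_lt hn hk hu; have := half_lt hn hk hx; omega)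
  intro he
  unfold edgeColor at he
  split_ifs at he with h1 h2 h2
  · exact hvw (h1.unique hu h2)
  · exact (hlt w hw).ne he.symm
  · exact (hlt v hv).ne he
  · rcases h.extra_of_half_eq hn hk hu hv hw h' hvw
      (reduce_inj (half_lt hn hk hv) (half_lt hn hk hw) he) with h3 | h3
    · exact h1 h3
    · exact h2 h3

end CyclePower

/-! ### Circulant graphs -/

/-- A total colouring from a colouring of the vertices and a colouring of ordered pairs of vertices
by natural numbers, with conditions on the adjacent pairs only. -/
theorem SimpleGraph.totallyColorable_of_pairs {V : Type*} (G : SimpleGraph V) (K : ℕ) (cv : V → ℕ)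
    (ce : V → V → ℕ) (hcv : ∀ u, cv u < K) (hce : ∀ u v, G.Adj u v → ce u v < K)
    (hsymm : ∀ u v, G.Adj u v → ce u v = ce v u)
    (hv : ∀ u v, G.Adj u v → cv u ≠ cv v)
    (he : ∀ u v w, G.Adj u v → G.Adj u w → v ≠ w → ce u v ≠ ce u w)
    (hi : ∀ u v, G.Adj u v → cv u ≠ ce u v) : G.TotallyColorable K := by
  have hout : ∀ e : G.edgeSet, G.Adj (Quot.out (e : Sym2 V)).1 (Quot.out (e : Sym2 V)).2 := by
    intro e
    rw [← SimpleGraph.mem_edgeSet]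
    have h : s((Quot.out (e : Sym2 V)).1, (Quot.out (e : Sym2 V)).2) = e := Quot.out_eq _
    rw [h]
    exact e.2
  have hval : ∀ e : G.edgeSet, ∀ u v, (e : Sym2 V) = s(u, v) →
      ce (Quot.out (e : Sym2 V)).1 (Quot.out (e : Sym2 V)).2 = ce u v := by
    intro e u v h
    have h1 : s((Quot.out (e : Sym2 V)).1, (Quot.out (e : Sym2 V)).2) = s(u, v) :=
      (Quot.out_eq (e : Sym2 V)).trans h
    have h2 := hout e
    rw [Sym2.eq_iff] at h1
    rcases h1 with ⟨h3, h4⟩ | ⟨h3, h4⟩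
    · rw [h3, h4]
    · rw [h3, h4] at h2 ⊢
      exact hsymm _ _ h2
  have hadj : ∀ e : G.edgeSet, ∀ u v, (e : Sym2 V) = s(u, v) → G.Adj u v := by
    intro e u v h
    rw [← SimpleGraph.mem_edgeSet, ← h]
    exact e.2
  refine ⟨fun u => ⟨cv u, hcv u⟩, fun e => ⟨_, hce _ _ (hout e)⟩, ?_, ?_, ?_⟩
  · intro u v h heq
    exact hv u v h (congrArg Fin.val heq)
  · rintro e f hef ⟨u, ⟨v, hev⟩, ⟨w, hfw⟩⟩ heq
    have h1 := congrArg Fin.val heq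
    simp only [hval e u v hev, hval f u w hfw] at h1
    refine he u v w (hadj e u v hev) (hadj f u w hfw) ?_ h1
    rintro rfl
    exact hef (Subtype.ext (hev.trans hfw.symm))
  · rintro u e ⟨v, hev⟩ heq
    have h1 := congrArg Fin.val heq
    simp only [hval e u v hev] at h1
    exact hi u v (hadj e u v hev) h1

theorem neg_mem_cyclePowerGenerators {n k : ℕ} (hk : k ≤ n) {s : ZMod n}
    (hs : s ∈ cyclePowerGenerators n k) : -s ∈ cyclePowerGenerators n k := by
  obtain ⟨d, h1, h2, h | h⟩ := hs
  · refine ⟨d, h1, h2, Or.inr ?_⟩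
    rw [h, Nat.cast_sub (h2.trans hk), ZMod.natCast_self, zero_sub]
  · refine ⟨d, h1, h2, Or.inl ?_⟩
    rw [h, Nat.cast_sub (h2.trans hk), ZMod.natCast_self, zero_sub, neg_neg]

theorem near_of_sub_mem {n k : ℕ} [NeZero n] (hk : k ≤ n) {u v : ZMod n}
    (h : v - u ∈ cyclePowerGenerators n k) : CyclePower.Near n k u.val v.val := by
  obtain ⟨d, h1, h2, h⟩ := h
  refine ⟨d, h1, h2, ?_⟩
  have hu := u.val_lt
  have hv := v.val_lt
  -- for two numbers below `2 n`, congruence leaves three possibilities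
  have key : ∀ a b : ℕ, a < 2 * n → b < 2 * n → (a : ZMod n) = b →
      a = b ∨ a = b + n ∨ a + n = b := by
    intro a b ha hb hab
    rw [ZMod.natCast_eq_natCast_iff'] at hab
    have h3 := Nat.div_add_mod a n
    have h4 := Nat.div_add_mod b n
    have h5 : a / n < 2 := Nat.div_lt_of_lt_mul (by omega)
    have h6 : b / n < 2 := Nat.div_lt_of_lt_mul (by omega)
    interval_cases a / n <;> interval_cases b / n <;> omega
  rcases h with h | h
  · have h3 : ((v.val : ℕ) : ZMod n) = ((u.val + d : ℕ) : ZMod n) := by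
      rw [Nat.cast_add, ZMod.natCast_zmod_val, ZMod.natCast_zmod_val, ← h]; abel
    have := key _ _ (by omega) (by omega) h3
    omega
  · rw [Nat.cast_sub (h2.trans hk), ZMod.natCast_self, zero_sub] at h
    have h3 : ((v.val + d : ℕ) : ZMod n) = ((u.val : ℕ) : ZMod n) := by
      rw [Nat.cast_add, ZMod.natCast_zmod_val, ZMod.natCast_zmod_val,
        show (d : ZMod n) = -(v - u) by rw [h, neg_neg]]; abel
    have := key _ _ (by omega) (by omega) h3
    omega

theorem two_mul_le_card_of_cyclePowerGenerators_subset {n k : ℕ} (hk : 2 * k < n)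
    (s : Finset (ZMod n)) (hs : cyclePowerGenerators n k ⊆ (s : Set (ZMod n))) :
    2 * k ≤ s.card := by
  have h1 : (Finset.Icc 1 k ∪ Finset.Ico (n - k) n).card = 2 * k := by
    rw [Finset.card_union_of_disjoint, Nat.card_Icc, Nat.card_Ico]
    · omega
    · rw [Finset.disjoint_left]
      intro a ha hb
      rw [Finset.mem_Icc] at ha
      rw [Finset.mem_Ico] at hb
      omega
  rw [← h1]
  refine Finset.card_le_card_of_injOn (fun d : ℕ => (d : ZMod n)) ?_ ?_
  · intro d hd
    rw [Finset.mem_coe, Finset.mem_union, Finset.mem_Icc, Finset.mem_Ico] at hd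
    apply hs
    rcases hd with hd | hd
    · exact ⟨d, hd.1, hd.2, Or.inl rfl⟩
    · exact ⟨n - d, by omega, by omega, Or.inr (by rw [Nat.sub_sub_self (by omega)])⟩
  · intro a ha b hb hab
    rw [Finset.mem_coe, Finset.mem_union, Finset.mem_Icc, Finset.mem_Ico] at ha hb
    have h2 : a % n = b % n := (ZMod.natCast_eq_natCast_iff' a b n).1 hab
    rwa [Nat.mod_eq_of_lt (by omega), Nat.mod_eq_of_lt (by omega)] at h2

theorem theorem3p1 (n : ℕ) [NeZero n] (hn : Even n)
    (S : Finset (ZMod n)) (h_zero : (0 : ZMod n) ∉ S) (h_symm : ∀ s ∈ S, -s ∈ S)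
    (G : SimpleGraph (ZMod n)) [DecidableRel G.Adj]
    (hG : G = SimpleGraph.addCayley (S : Set (ZMod n)))
    (h_deg : (n : ℚ) / 2 ≤ (G.maxDegree : ℚ))
    (h_inv : ((n / 2 : ℕ) : ZMod n) ∉ S)
    (h_sub : cyclePowerGenerators n (n / 4) ⊆ (S : Set (ZMod n)))
    (h_gen : AddSubgroup.closure ((S : Set (ZMod n)) \ cyclePowerGenerators n (n / 4)) = ⊤) :
    G.totalChromaticNumber ≤ (G.maxDegree : ℕ∞) + 2 := by
  classical
  have hadj : ∀ u v, G.Adj u v ↔ v - u ∈ S := by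
    intro u v
    rw [hG, SimpleGraph.addCayley_adj']
    constructor
    · rintro ⟨-, g, hg, h | h⟩
      · rw [← h, add_sub_cancel_left]; exact hg
      · rw [h, sub_add_cancel_left]; exact h_symm g hg
    · intro h
      refine ⟨?_, v - u, h, Or.inl (add_sub_cancel _ _)⟩
      rintro rfl
      rw [sub_self] at h
      exact h_zero h
  have hmax : S.card ≤ G.maxDegree := by
    refine le_trans ?_ (G.degree_le_maxDegree 0)
    refine Finset.card_le_card fun s hs => ?_
    rw [SimpleGraph.mem_neighborFinset, hadj, sub_zero]
    exact hs
  set k := n / 4 with hk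
  have hn0 : 0 < n := Nat.pos_of_ne_zero (NeZero.ne n)
  have hkn : k ≤ n := Nat.div_le_self _ _
  set T := S.filter (fun s => s ∉ cyclePowerGenerators n k) with hT
  have hcard : T.card + 2 * k ≤ S.card := by
    have h1 := two_mul_le_card_of_cyclePowerGenerators_subset (k := k) (by omega)
      (S.filter (fun s => s ∈ cyclePowerGenerators n k))
      (fun s hs => by rw [Finset.coe_filter]; exact ⟨h_sub hs, hs⟩)
    have h2 : (S.filter (fun s => s ∈ cyclePowerGenerators n k)).card + T.card = S.card := by
      convert Finset.card_filter_add_card_filter_not (s := S) _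
    omega
  -- `T` generates the group, so it is not contained in the subgroup of index two
  let π : ZMod n →+ ZMod 2 := (ZMod.castHom hn.two_dvd (ZMod 2)).toAddMonoidHom
  obtain ⟨a, haT, hπa⟩ : ∃ a ∈ T, π a ≠ 0 := by
    by_contra! h
    have h1 : AddSubgroup.closure ((S : Set (ZMod n)) \ cyclePowerGenerators n k) ≤ π.ker := by
      rw [AddSubgroup.closure_le]
      rintro s ⟨hs, hs'⟩
      exact h s (Finset.mem_filter.2 ⟨hs, hs'⟩)
    rw [h_gen] at h1
    have h2 : π 1 = 0 := h1 (AddSubgroup.mem_top 1)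
    have h3 : π 1 = 1 := map_one (ZMod.castHom hn.two_dvd (ZMod 2))
    rw [h2] at h3
    exact zero_ne_one h3
  obtain ⟨F, hFs, hF⟩ := exists_edge_coloring_of_odd_generator π T
    (fun h => h_zero (Finset.mem_filter.1 h).1)
    (fun s hs => by
      rw [hT, Finset.mem_filter] at hs ⊢
      refine ⟨h_symm s hs.1, fun h => hs.2 ?_⟩
      rw [← neg_neg s]
      exact neg_mem_cyclePowerGenerators hkn h) haT hπa
  let P : ZMod n → ZMod n → Prop := fun u v => v - u ∈ cyclePowerGenerators n k
  have hPs : ∀ u v, P u v → P v u := fun u v h => by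
    have := neg_mem_cyclePowerGenerators hkn h
    rwa [neg_sub] at this
  have hnear : ∀ u v, P u v → CyclePower.Near n k u.val v.val := fun u v h =>
    near_of_sub_mem hkn h
  have hPT : ∀ u v, G.Adj u v → ¬ P u v → v - u ∈ T := fun u v h h' =>
    Finset.mem_filter.2 ⟨(hadj u v).1 h, h'⟩
  have hval : ∀ u : ZMod n, u.val < n := fun u => u.val_lt
  have hvne : ∀ u v : ZMod n, u ≠ v → u.val ≠ v.val := fun u v h h' =>
    h (ZMod.val_injective n h')
  -- the two parts of the graph use disjoint sets of colours; both colour edges, only the first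
  -- colours vertices, and there each vertex has a colour below `2 k + 1`
  let cv : ZMod n → ℕ := fun u => CyclePower.vertexColor n k u.val
  let ce : ZMod n → ZMod n → ℕ := fun u v =>
    if P u v then CyclePower.edgeColor n k u.val v.val else 2 * k + 2 + (F u v : ℕ)
  have hcv : ∀ u, cv u < 2 * k + 1 := fun u => CyclePower.vertexColor_lt hn hk (hval u)
  have hce : ∀ u v, P u v → ce u v = CyclePower.edgeColor n k u.val v.val := fun u v h => if_pos h
  have hce' : ∀ u v, ¬ P u v → ce u v = 2 * k + 2 + (F u v : ℕ) := fun u v h => if_neg h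
  have hlt : ∀ u v, P u v → ce u v < 2 * k + 2 := fun u v h => by
    rw [hce u v h]
    exact CyclePower.edgeColor_lt hn hk (hval u) (hval v)
  have hcol : G.TotallyColorable (G.maxDegree + 2) := by
    refine G.totallyColorable_of_pairs _ cv ce (fun u => by have := hcv u; omega) ?_ ?_ ?_ ?_ ?_
    · intro u v h
      by_cases hP : P u v
      · have := hlt u v hP
        omega
      · rw [hce' u v hP]
        have := (F u v).isLt
        omega
    · intro u v h
      by_cases hP : P u v
      · rw [hce u v hP, hce v u (hPs u v hP), CyclePower.edgeColor_comm]
      · rw [hce' u v hP, hce' v u (fun h' => hP (hPs v u h')), hFs u v (hPT u v h hP)]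
    · -- vertices of the same colour differ by `n / 2`, which is not a generator
      intro u v h heq
      rw [hadj] at h
      have hcast : ∀ x y : ZMod n, y.val = x.val + n / 2 → y - x = ((n / 2 : ℕ) : ZMod n) := by
        intro x y hxy
        rw [← ZMod.natCast_zmod_val y, hxy, Nat.cast_add, ZMod.natCast_zmod_val,
          add_sub_cancel_left]
      rcases CyclePower.eq_or_eq_add_of_vertexColor_eq heq with h1 | h1 | h1
      · rw [ZMod.val_injective n h1, sub_self] at h
        exact h_zero h
      · exact h_inv (hcast u v h1 ▸ h)
      · have h2 := h_symm _ h
        rw [neg_sub, hcast v u h1] at h2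
        exact h_inv h2
    · intro u v w hv hw hvw
      by_cases h1 : P u v <;> by_cases h2 : P u w
      · rw [hce u v h1, hce u w h2]
        exact (hnear u v h1).edgeColor_ne hn hk (hval u) (hval v) (hval w) (hnear u w h2)
          (hvne v w hvw)
      · have := hlt u v h1
        rw [hce' u w h2]
        omega
      · have := hlt u w h2
        rw [hce' u v h1]
        omega
      · rw [hce' u v h1, hce' u w h2]
        intro h
        exact hvw (hF u v w (hPT u v hv h1) (hPT u w hw h2) (Fin.ext (by omega)))
    · intro u v h
      by_cases hP : P u v
      · rw [hce u v hP]
        exact (hnear u v hP).vertexColor_ne_edgeColor hn hk (hval u) (hval v)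
      · have := hcv u
        rw [hce' u v hP]
        omega
  exact iInf_le (fun k : {k : ℕ // G.TotallyColorable k} => ((k : ℕ) : ℕ∞)) ⟨_, hcol⟩
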